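/- Let $k \ge 1$ be an integer and let $G$ be a finite simple graph that is $(2k-1)$-vertex-connected, i.e. $G$ has more than $2k-1$ vertices and remains connected after the removal of any set of fewer than $2k-1$ vertices. Let $\Delta(G)$ be the maximum degree of $G$, and let $T(G)$ be the total graph of $G$: its vertex set is $V(G) \cup E(G)$, and two of its vertices are adjacent if and only if they are adjacent vertices of $G$, distinct edges of $G$ sharing an endpoint, or a vertex of $G$ and an edge of $G$ incident with it. Then the complete graph $K_{\Delta(G)+k}$ is a minor of $T(G)$; that is, a graph isomorphic to $K_{\Delta(G)+k}$ can be obtained from $T(G)$ by a finite sequence of vertex deletions, edge deletions and edge contractions. -/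

import Mathlib

namespace SimpleGraph

universe u w

/-- A finite graph is `k`-(vertex-)connected if it has more than `k` vertices and it stays connected
after the removal of any set of fewer than `k` vertices. -/
def IsVertexConnected {V : Type u} [Fintype V] (G : SimpleGraph V) (k : ℕ) : Prop :=
  k < Fintype.card V ∧
    ∀ X : Finset V, X.card < k → (G.induce ((X : Set V)ᶜ)).Connected

/-- The total graph of `G`: its vertices are the elements of `G`, that is, the vertices and the
edges of `G`. Two vertices are adjacent if they are adjacent in `G`, two edges are adjacent if they
are distinct and share an endpoint, and a vertex and an edge are adjacent if the vertex is an
endpoint of the edge. -/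
def totalGraph {V : Type u} (G : SimpleGraph V) : SimpleGraph (V ⊕ G.edgeSet) where
  Adj a b :=
    match a, b with
    | .inl u, .inl v => G.Adj u v
    | .inl v, .inr e => v ∈ (e : Sym2 V)
    | .inr e, .inl v => v ∈ (e : Sym2 V)
    | .inr e, .inr f => G.lineGraph.Adj e f
  symm.symm a b h := by
    match a, b, h with
    | .inl _, .inl _, h => exact SimpleGraph.Adj.symm h
    | .inl _, .inr _, h => exact h
    | .inr _, .inl _, h => exact h
    | .inr _, .inr _, h => exact SimpleGraph.Adj.symm h
  loopless.irrefl a h := by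
    match a, h with
    | .inl _, h => exact G.irrefl h
    | .inr _, h => exact G.lineGraph.irrefl h

/-- The contraction `G / uv` of an edge `uv`: the vertices `u` and `v` are deleted, and a new
vertex (`none`) is introduced, whose neighbours are the vertices other than `u` and `v` that are
adjacent in `G` to `u` or to `v`. -/
def contractEdge {V : Type u} (G : SimpleGraph V) (u v : V) :
    SimpleGraph (Option {x : V // x ≠ u ∧ x ≠ v}) where
  Adj a b :=
    match a, b with
    | none, none => False
    | none, some y => G.Adj u y ∨ G.Adj v y
    | some x, none => G.Adj u x ∨ G.Adj v x
    | some x, some y => G.Adj x y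
  symm.symm a b h := by
    match a, b, h with
    | none, some _, h => exact h
    | some _, none, h => exact h
    | some _, some _, h => exact SimpleGraph.Adj.symm h
  loopless.irrefl a h := by
    match a, h with
    | some _, h => exact G.irrefl h

/-- `H.IsMinor G`: a graph isomorphic to `H` can be obtained from `G` by a finite (possibly empty)
sequence of vertex deletions, edge deletions and edge contractions. -/
inductive IsMinor {W : Type w} (H : SimpleGraph W) : {V : Type u} → SimpleGraph V → Prop
  | iso {V : Type u} {G : SimpleGraph V} (φ : H ≃g G) : IsMinor H G
  | deleteVertex {V : Type u} {G : SimpleGraph V} (v : V)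
      (h : IsMinor H (G.induce ({v}ᶜ : Set V))) : IsMinor H G
  | deleteEdge {V : Type u} {G : SimpleGraph V} (e : Sym2 V) (he : e ∈ G.edgeSet)
      (h : IsMinor H (G.deleteEdges {e})) : IsMinor H G
  | contractEdge {V : Type u} {G : SimpleGraph V} (u v : V) (huv : G.Adj u v)
      (h : IsMinor H (G.contractEdge u v)) : IsMinor H G

end SimpleGraph

/-! Write `k = m + 1` and let `v` have maximum degree. Then `G - v` is `2m`-connected, hence
`2m`-edge-connected (`le_card_cut_of_cutConnected`), so it has `m` edge-disjoint connected spanning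
subgraphs (`exists_disjoint_spanning`). The branch sets in `T(G)` are `V(G)`, each single edge at
`v`, and these `m` edge sets. `V(G)` touches all others, edges at `v` share `v`, an edge `vu` meets
each spanning subgraph at `u`, and two spanning subgraphs meet at every vertex of `G - v`. This
makes `1 + Δ + m = Δ + k` sets.

Tree packing comes from matroid partition for the incidence vectors over `ZMod 2`: a maximum packing
of independent sets has a set `X`, containing all uncoloured edges, whose span every colour attains
within `X`. Counting coloured edges against cuts shows that `X` already connects all vertices, so
every colour does. -/

/-! ### Packing independent sets by exchanges -/

/-- The fundamental circuit: the combination giving `x` is unique, so no index in its support can be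
dropped. -/
theorem LinearIndepOn.mem_span_image_setOf_notMem_span {ι K M : Type*} [DivisionRing K]
    [AddCommGroup M] [Module K M] {v : ι → M} {s : Set ι} (hs : LinearIndepOn K v s) {x : M}
    (hx : x ∈ Submodule.span K (v '' s)) :
    x ∈ Submodule.span K (v '' {i ∈ s | x ∉ Submodule.span K (v '' (s \ {i}))}) := by
  rw [Finsupp.mem_span_image_iff_linearCombination] at hx ⊢
  obtain ⟨l, hl, rfl⟩ := hx
  refine ⟨l, fun i hi => ⟨hl hi, fun hmem => ?_⟩, rfl⟩
  rw [Finsupp.mem_span_image_iff_linearCombination] at hmem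
  obtain ⟨l', hl', he⟩ := hmem
  have : l' = l := linearIndepOn_iffₛ.1 hs l'
    (Finsupp.supported_mono Set.sdiff_subset hl') l hl he
  subst this
  exact (hl' hi).2 rfl

/-- A partial colouring of the index set all of whose colour classes are linearly independent. -/
def IsIndepPacking (K : Type*) {E M ι : Type*} [DivisionRing K] [AddCommGroup M] [Module K M]
    (v : E → M) (c : E → Option ι) : Prop :=
  ∀ i, LinearIndepOn K v {e | c e = some i}

namespace IsIndepPacking

variable {K E M ι : Type*} [DivisionRing K] [AddCommGroup M] [Module K M] {v : E → M}
  {c c₀ : E → Option ι}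

/-- Exchanging an uncoloured element `e` for a coloured element `g`. -/
def Exchange [DecidableEq E] (K : Type*) [DivisionRing K] [Module K M] (v : E → M)
    (c c' : E → Option ι) : Prop :=
  ∃ e g i, c e = none ∧ c g = some i ∧
    c' = Function.update (Function.update c g none) e (some i) ∧ IsIndepPacking K v c'

open Classical in
theorem exists_forall_card_le [Finite E] (K : Type*) [DivisionRing K] [Module K M] (v : E → M)
    (ι : Type*) : ∃ c : E → Option ι, IsIndepPacking K v c ∧
      ∀ c' : E → Option ι, IsIndepPacking K v c' →
        Nat.card {e // c' e ≠ none} ≤ Nat.card {e // c e ≠ none} := by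
  have hb : ∀ c : E → Option ι, Nat.card {e // c e ≠ none} ≤ Nat.card E := fun c =>
    Finite.card_subtype_le _
  set P : ℕ → Prop := fun n =>
    ∃ c : E → Option ι, IsIndepPacking K v c ∧ Nat.card {e // c e ≠ none} = n
  have h0 : P (Nat.card {e : E // (none : Option ι) ≠ none}) :=
    ⟨fun _ => none, fun i => by simp, rfl⟩
  obtain ⟨c, hc, hn⟩ := Nat.findGreatest_spec (P := P) (hb fun _ => none) h0
  refine ⟨c, hc, fun c' hc' => ?_⟩
  rw [hn]
  exact Nat.le_findGreatest (hb c') ⟨c', hc', rfl⟩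

/-- In a packing of maximum size, there is a set `X` containing all uncoloured elements, whose span
is spanned by its part in each colour class. -/
theorem exists_span_le [Finite E] (K : Type*) [DivisionRing K] [Module K M] (v : E → M)
    (ι : Type*) : ∃ (c : E → Option ι) (X : Set E), IsIndepPacking K v c ∧
      (∀ e, c e = none → e ∈ X) ∧
      ∀ i, Submodule.span K (v '' X) ≤ Submodule.span K (v '' {e | c e = some i ∧ e ∈ X}) := by
  classical
  obtain ⟨c₀, h₀, hmax⟩ := exists_forall_card_le K v ι
  -- The elements left uncoloured by some packing reachable from `c₀`; all these packings are
  -- maximum.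
  set X : Set E :=
    {e | ∃ c : E → Option ι, Relation.ReflTransGen (Exchange K v) c₀ c ∧ c e = none}
  have hcard : ∀ c : E → Option ι, Relation.ReflTransGen (Exchange K v) c₀ c →
      IsIndepPacking K v c ∧ Nat.card {e // c e ≠ none} = Nat.card {e // c₀ e ≠ none} := by
    intro c hc
    induction hc with
    | refl => exact ⟨h₀, rfl⟩
    | @tail b c _ hbc ih =>
      obtain ⟨e, g, i, he, hg, rfl, hi⟩ := hbc
      refine ⟨hi, ?_⟩
      rw [← ih.2]
      have hne : e ≠ g := by
        rintro rfl
        simp [he] at hg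
      refine Nat.card_congr ((Equiv.swap e g).subtypeEquiv fun x => ?_)
      rcases eq_or_ne x e with rfl | hxe
      · simp [hg]
      rcases eq_or_ne x g with rfl | hxg
      · simp [hxe, he]
      · simp [hxe, hxg, Equiv.swap_apply_of_ne_of_ne]
  have hmem : ∀ c : E → Option ι, Relation.ReflTransGen (Exchange K v) c₀ c → ∀ e, c e = none → ∀ i,
      v e ∈ Submodule.span K (v '' {f | c f = some i ∧ f ∈ X}) := by
    intro c hc e he i
    obtain ⟨hind, hn⟩ := hcard c hc
    have heF : e ∉ {f | c f = some i} := by simp [he]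
    -- Otherwise giving `e` the colour `i` would enlarge a maximum packing.
    have hdep : v e ∈ Submodule.span K (v '' {f | c f = some i}) := by
      by_contra hcon
      have hins := (linearIndepOn_insert heF).2 ⟨hind i, hcon⟩
      have hpack : IsIndepPacking K v (Function.update c e (some i)) := by
        intro j
        rcases eq_or_ne j i with rfl | hj
        · refine hins.mono fun f hf => ?_
          rcases eq_or_ne f e with rfl | hfe
          · simp
          · right
            simpa [hfe] using hf
        · refine (hind j).mono fun f hf => ?_
          rcases eq_or_ne f e with rfl | hfe
          · simp [hj.symm] at hf
          · simpa [hfe] using hf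
      have hlt : Nat.card {f // c f ≠ none} <
          Nat.card {f // Function.update c e (some i) f ≠ none} := by
        refine Set.ncard_lt_ncard (s := {f | c f ≠ none})
          (t := {f | Function.update c e (some i) f ≠ none}) ?_ (Set.toFinite _)
        refine (Set.ssubset_iff_of_subset fun f hf => ?_).2 ⟨e, by simp, by simp [he]⟩
        rcases eq_or_ne f e with rfl | hfe
        · simp
        · simpa [hfe] using hf
      have := hmax _ hpack
      omega
    -- Each `g` in the fundamental circuit of `e` can be exchanged for `e`, so it becomes uncoloured
    -- and lies in `X`.
    refine Submodule.span_mono (Set.image_mono ?_)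
      ((hind i).mem_span_image_setOf_notMem_span hdep)
    rintro g ⟨hg, hgs⟩
    refine ⟨hg, Function.update (Function.update c g none) e (some i),
      hc.tail ⟨e, g, i, he, hg, rfl, ?_⟩, ?_⟩
    · intro j
      rcases eq_or_ne j i with rfl | hj
      · have : e ∉ {f | c f = some j} \ {g} := fun h => heF h.1
        refine ((linearIndepOn_insert this).2
          ⟨(hind j).mono Set.sdiff_subset, hgs⟩).mono fun f hf => ?_
        rcases eq_or_ne f e with rfl | hfe
        · simp
        rcases eq_or_ne f g with rfl | hfg
        · simp [hfe] at hf
        · right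
          simpa [hfe, hfg] using hf
      · refine (hind j).mono fun f hf => ?_
        rcases eq_or_ne f e with rfl | hfe
        · simp [hj.symm] at hf
        rcases eq_or_ne f g with rfl | hfg
        · simp [hfe] at hf
        · simpa [hfe, hfg] using hf
    · have : g ≠ e := by
        rintro rfl
        exact heF hg
      simp [this]
  refine ⟨c₀, X, h₀, fun e he => ⟨c₀, .refl, he⟩, fun i => ?_⟩
  -- An exchange adds only `e` to a class, and `hmem` puts `v e` in the span before the exchange.
  have hspan : ∀ c : E → Option ι, Relation.ReflTransGen (Exchange K v) c₀ c →
      Submodule.span K (v '' {f | c f = some i ∧ f ∈ X}) ≤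
        Submodule.span K (v '' {f | c₀ f = some i ∧ f ∈ X}) := by
    intro c hc
    induction hc with
    | refl => exact le_rfl
    | @tail b c hb hbc ih =>
      refine le_trans ?_ ih
      obtain ⟨e, g, j, he, hg, rfl, -⟩ := hbc
      rw [Submodule.span_le]
      rintro _ ⟨f, ⟨hf, hfX⟩, rfl⟩
      rcases eq_or_ne f e with rfl | hfe
      · exact hmem b hb f he i
      rcases eq_or_ne f g with rfl | hfg
      · simp [hfe] at hf
      · exact Submodule.subset_span ⟨f, ⟨by simpa [hfe, hfg] using hf, hfX⟩, rfl⟩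
  rw [Submodule.span_le]
  rintro _ ⟨e, ⟨c, hc, he⟩, rfl⟩
  exact hspan c hc (hmem c hc e he i)

end IsIndepPacking

/-! ### Tree packing -/

namespace SimpleGraph

universe u

section EdgeVector

variable {V : Type u} [DecidableEq V]

/-- The column of the incidence matrix modulo two at an edge. -/
def edgeVec : Sym2 V → V → ZMod 2 :=
  Sym2.lift ⟨fun a b => Pi.single a 1 + Pi.single b 1, fun _ _ => add_comm _ _⟩

@[simp]
theorem edgeVec_mk (a b : V) : edgeVec s(a, b) = Pi.single a 1 + Pi.single b 1 := rfl

/-- The sum of the coordinates in `C`. -/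
def coordSum [Fintype V] (C : Set V) [DecidablePred (· ∈ C)] : (V → ZMod 2) →ₗ[ZMod 2] ZMod 2 :=
  ∑ x with x ∈ C, LinearMap.proj x

theorem coordSum_single [Fintype V] (C : Set V) [DecidablePred (· ∈ C)] (a : V) :
    coordSum C (Pi.single a 1) = if a ∈ C then 1 else 0 := by
  simp [coordSum, Pi.single_apply, Finset.sum_ite_eq']

/-- The functional detects whether the edge `ab` crosses the cut `C`. -/
theorem coordSum_add_eq_zero_iff [Fintype V] (C : Set V) [DecidablePred (· ∈ C)] (a b : V) :
    coordSum C (Pi.single a 1 + Pi.single b 1) = 0 ↔ (a ∈ C ↔ b ∈ C) := by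
  rw [map_add, coordSum_single, coordSum_single]
  by_cases ha : a ∈ C <;> by_cases hb : b ∈ C <;> simp [ha, hb]
  decide

theorem finrank_quotient_le_card_image [Fintype V] (S : Submodule (ZMod 2) (V → ZMod 2))
    [DecidableEq ((V → ZMod 2) ⧸ S)] :
    Module.finrank (ZMod 2) ((V → ZMod 2) ⧸ S) ≤
      (Finset.univ.image fun a : V => S.mkQ (Pi.single a 1)).card := by
  set Q := Finset.univ.image fun a : V => S.mkQ (Pi.single a 1) with hQ
  have h := finrank_span_finset_le_card (R := ZMod 2) Q
  have htop : Submodule.span (ZMod 2) (Q : Set ((V → ZMod 2) ⧸ S)) = ⊤ := by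
    have he : (Q : Set ((V → ZMod 2) ⧸ S)) = S.mkQ '' Set.range (Pi.basisFun (ZMod 2) V) := by
      ext
      simp [hQ]
    rw [he, ← Submodule.map_span, (Pi.basisFun (ZMod 2) V).span_eq, Submodule.map_top,
      Submodule.range_mkQ]
  rwa [Set.finrank, htop, finrank_top] at h

end EdgeVector

theorem card_filter_ne_none {E ι : Type*} [Fintype E] [Fintype ι] [DecidableEq ι]
    (c : E → Option ι) (p : E → Prop) [DecidablePred p] :
    (Finset.univ.filter fun e => c e ≠ none ∧ p e).card =
      ∑ i, (Finset.univ.filter fun e => c e = some i ∧ p e).card := by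
  simp only [Finset.card_filter]
  rw [Finset.sum_comm]
  refine Finset.sum_congr rfl fun e _ => ?_
  rcases h : c e with _ | j
  · simp
  · by_cases hp : p e <;> simp [hp]

variable {V : Type u} {G : SimpleGraph V}

open Classical in
/-- If the cut around every class of `q` has at least `2 * m` edges, then at least `m` edges per
class join distinct classes. -/
theorem mul_card_image_le_card_edges [Fintype V] {α : Type*} [DecidableEq α] (q : V → α) {m : ℕ}
    (h : ∀ z ∈ Finset.univ.image q,
      2 * m ≤ (Finset.univ.filter fun p : V × V => G.Adj p.1 p.2 ∧ q p.1 = z ∧ q p.2 ≠ z).card)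
    (X : Set G.edgeSet) (hX : ∀ a b (hab : G.Adj a b), ⟨s(a, b), hab⟩ ∈ X → q a = q b) :
    (Finset.univ.image q).card * m ≤ (Finset.univ.filter fun e : G.edgeSet => e ∉ X).card := by
  set D := Finset.univ.filter fun p : V × V => G.Adj p.1 p.2 ∧ q p.1 ≠ q p.2 with hD
  have h1 : (Finset.univ.image q).card * (2 * m) ≤ D.card := by
    rw [Finset.card_eq_sum_card_fiberwise (f := fun p : V × V => q p.1) (s := D)
      (t := Finset.univ.image q) (fun p _ => by simp), ← smul_eq_mul]
    refine Finset.card_nsmul_le_sum _ _ _ fun z hz => (h z hz).trans (Finset.card_le_card ?_)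
    intro p
    simp only [hD, Finset.mem_filter, Finset.mem_univ, true_and]
    rintro ⟨h1, rfl, h2⟩
    exact ⟨⟨h1, h2.symm⟩, rfl⟩
  -- `D` holds both orientations of an edge; this absorbs the factor 2 in the cut bound.
  have h2 : D.card ≤ 2 * (D.image fun p => s(p.1, p.2)).card := by
    refine Finset.card_le_mul_card_image _ _ fun e _ => ?_
    induction e with
    | _ a b =>
      refine (Finset.card_le_card (t := {(a, b), (b, a)}) ?_).trans Finset.card_le_two
      rintro ⟨x, y⟩ hxy
      simpa using (Finset.mem_filter.1 hxy).2
  have h3 : (D.image fun p => s(p.1, p.2)) ⊆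
      (Finset.univ.filter fun e : G.edgeSet => e ∉ X).image Subtype.val := by
    rintro e he
    obtain ⟨⟨a, b⟩, hp, rfl⟩ := Finset.mem_image.1 he
    simp only [hD, Finset.mem_filter, Finset.mem_univ, true_and] at hp
    exact Finset.mem_image.2 ⟨⟨s(a, b), hp.1⟩, by simpa using fun hm => hp.2 (hX a b hp.1 hm), rfl⟩
  have h4 := (Finset.card_le_card h3).trans Finset.card_image_le
  have h5 := (h1.trans h2).trans (Nat.mul_le_mul_left 2 h4)
  linarith

open Classical in
/-- Tree packing: a `2 * m`-edge-connected graph has `m` edge-disjoint connected spanning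
subgraphs. -/
theorem exists_disjoint_spanning [Fintype V] (m : ℕ)
    (hcut : ∀ C : Set V, C.Nonempty → Cᶜ.Nonempty →
      2 * m ≤ (Finset.univ.filter fun p : V × V => G.Adj p.1 p.2 ∧ p.1 ∈ C ∧ p.2 ∉ C).card) :
    ∃ c : G.edgeSet → Option (Fin m), ∀ (i : Fin m) (C : Set V),
      (∀ a b (hab : G.Adj a b), c ⟨s(a, b), hab⟩ = some i → (a ∈ C ↔ b ∈ C)) →
        ∀ a b, a ∈ C → b ∈ C := by
  set v : G.edgeSet → V → ZMod 2 := fun e => edgeVec (e : Sym2 V)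
  obtain ⟨c, X, hc, hX, hspan⟩ := IsIndepPacking.exists_span_le (ZMod 2) v (Fin m)
  refine ⟨c, fun i C hC a b ha => ?_⟩
  set S := Submodule.span (ZMod 2) (v '' X)
  set q : V → (V → ZMod 2) ⧸ S := fun a => S.mkQ (Pi.single a 1)
  have hqiff : ∀ a b, q a = q b ↔ Pi.single a 1 + Pi.single b 1 ∈ S := by
    intro a b
    change S.mkQ _ = S.mkQ _ ↔ _
    rw [Submodule.mkQ_apply, Submodule.mkQ_apply, Submodule.Quotient.eq,
      ← ZModModule.sub_eq_add]
  -- With two or more classes, at least `m * finrank S` coloured edges lie in `X` and at least `m`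
  -- per class outside it, in total at least `m * |V|`; but each colour has fewer than `|V|` edges.
  have hconst : ∀ x y, q x = q y := by
    by_contra! hne
    obtain ⟨x, y, hxy⟩ := hne
    have hclass := mul_card_image_le_card_edges (G := G) q (m := m) (fun z hz => by
      obtain ⟨x', -, rfl⟩ := Finset.mem_image.1 hz
      refine hcut (q ⁻¹' {q x'}) ⟨x', rfl⟩ ?_
      by_cases hx : q x = q x'
      · exact ⟨y, fun hy => hxy (hx.trans (Eq.symm hy))⟩
      · exact ⟨x, hx⟩) X
      (fun a b hab hm => (hqiff a b).2 (Submodule.subset_span ⟨_, hm, rfl⟩))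
    have hdim : Fintype.card V ≤
        (Finset.univ.image q).card + Module.finrank (ZMod 2) S := by
      have h1 := Submodule.finrank_quotient_add_finrank S
      rw [Module.finrank_fintype_fun_eq_card] at h1
      have h2 : Module.finrank (ZMod 2) ((V → ZMod 2) ⧸ S) ≤ (Finset.univ.image q).card :=
        finrank_quotient_le_card_image S
      omega
    have hlow : ∀ i, Module.finrank (ZMod 2) S ≤
        (Finset.univ.filter fun e => c e = some i ∧ e ∈ X).card := by
      intro i
      refine (Submodule.finrank_mono (hspan i)).trans ?_
      have h1 := finrank_span_finset_le_card (R := ZMod 2)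
        ((Finset.univ.filter fun e => c e = some i ∧ e ∈ X).image v)
      refine le_trans (le_of_eq ?_) (h1.trans Finset.card_image_le)
      rw [Set.finrank]
      congr 2
      all_goals simp
    have hup : ∀ i, (Finset.univ.filter fun e => c e = some i ∧ True).card <
        Fintype.card V := by
      intro i
      have h1 := finrank_span_eq_card (R := ZMod 2) (hc i)
      -- Every edge vector has coordinate sum zero.
      have h2 : Submodule.span (ZMod 2)
          (Set.range fun e : {e | c e = some i} => v e) ≠ ⊤ := by
        intro htop
        have hle : (⊤ : Submodule (ZMod 2) (V → ZMod 2)) ≤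
            LinearMap.ker (coordSum (Set.univ : Set V)) := by
          rw [← htop, Submodule.span_le]
          rintro _ ⟨⟨⟨e, he⟩, -⟩, rfl⟩
          induction e with
          | _ a b => exact (coordSum_add_eq_zero_iff _ a b).2 (by simp)
        have := hle (Submodule.mem_top (x := Pi.single a 1))
        rw [LinearMap.mem_ker, coordSum_single] at this
        simp at this
      have h3 := Submodule.finrank_lt h2
      rw [h1, Module.finrank_fintype_fun_eq_card, Fintype.card_subtype] at h3
      simpa using h3
    have hall := card_filter_ne_none c (fun _ => True)
    have hin := card_filter_ne_none c (· ∈ X)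
    have hout : (Finset.univ.filter fun e => c e ≠ none ∧ True).card =
        (Finset.univ.filter fun e => c e ≠ none ∧ e ∈ X).card +
          (Finset.univ.filter fun e => e ∉ X).card := by
      rw [← Finset.card_filter_add_card_filter_not (· ∈ X), Finset.filter_filter,
        Finset.filter_filter]
      congr 2
      · ext e
        simp
      · ext e
        simp only [Finset.mem_filter, Finset.mem_univ, true_and, and_true]
        exact ⟨fun h => h.2, fun h => ⟨fun hn => h (hX e hn), h⟩⟩
    have hsum1 : m * Module.finrank (ZMod 2) S ≤
        ∑ i, (Finset.univ.filter fun e => c e = some i ∧ e ∈ X).card := by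
      have := Finset.card_nsmul_le_sum Finset.univ _ _ fun i _ => hlow i
      simpa using this
    -- Strict because the colour `i` witnesses `m ≠ 0`.
    have hsum2 : ∑ i, (Finset.univ.filter fun e => c e = some i ∧ True).card <
        m * Fintype.card V := by
      have := Finset.sum_lt_sum_of_nonempty (s := Finset.univ) ⟨i, Finset.mem_univ i⟩
        fun i _ => hup i
      simpa using this
    nlinarith
  have hmem := hspan i ((hqiff a b).1 (hconst a b))
  have hle : Submodule.span (ZMod 2) (v '' {e | c e = some i ∧ e ∈ X}) ≤
      LinearMap.ker (coordSum C) := by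
    rw [Submodule.span_le]
    rintro _ ⟨⟨e, he⟩, ⟨hei, -⟩, rfl⟩
    induction e with
    | _ a b => exact (coordSum_add_eq_zero_iff C a b).2 (hC a b he hei)
  exact ((coordSum_add_eq_zero_iff C a b).1 (hle hmem)).1 ha

end SimpleGraph

/-! ### Vertex connectivity and edge cuts -/

namespace SimpleGraph

universe u

variable {V : Type u} {G : SimpleGraph V}

/-- The vertices outside `X` cannot be split into two parts without an edge between them. -/
def CutConnected (G : SimpleGraph V) (X : Set V) : Prop :=
  ∀ (C : Set V) (a b : V), a ∉ X → b ∉ X → a ∈ C → b ∉ C →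
    ∃ x y, x ∉ X ∧ y ∉ X ∧ x ∈ C ∧ y ∉ C ∧ G.Adj x y

theorem Connected.cutConnected {X : Set V} (h : (G.induce Xᶜ).Connected) : G.CutConnected X := by
  intro C a b ha hb haC hbC
  obtain ⟨p⟩ := h.preconnected ⟨a, ha⟩ ⟨b, hb⟩
  obtain ⟨d, -, h1, h2⟩ := p.exists_boundary_dart (Subtype.val ⁻¹' C) haC hbC
  exact ⟨d.fst, d.snd, d.fst.2, d.snd.2, h1, h2, d.adj⟩

/-- Removing `X` from `G - v` is removing `X ∪ {v}` from `G`. -/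
theorem IsVertexConnected.cutConnected_induce [Fintype V] {k : ℕ} (h : G.IsVertexConnected (k + 1))
    (v : V) (X : Finset ({v}ᶜ : Set V)) (hX : X.card < k) :
    (G.induce ({v}ᶜ : Set V)).CutConnected X := by
  classical
  have hc := (h.2 (insert v (X.map (Function.Embedding.subtype _)))
    ((Finset.card_insert_le _ _).trans_lt (by simpa using hX))).cutConnected
  intro C a b ha hb haC hbC
  have key : ∀ a : ({v}ᶜ : Set V), a ∉ (X : Set _) →
      (a : V) ∉ ((insert v (X.map (Function.Embedding.subtype _)) : Finset V) : Set V) := by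
    intro a ha hmem
    have hav : (a : V) ≠ v := a.2
    simp [hav] at hmem
    exact ha hmem
  obtain ⟨x, y, hx, hy, hxC, hyC, hxy⟩ := hc (Subtype.val '' C) a b (key a ha) (key b hb)
    ⟨a, haC, rfl⟩ (by rintro ⟨b', hb', he⟩; exact hbC (Subtype.ext he ▸ hb'))
  have hxv : x ∈ ({v}ᶜ : Set V) := by
    rintro rfl
    simp at hx
  have hyv : y ∈ ({v}ᶜ : Set V) := by
    rintro rfl
    simp at hy
  refine ⟨⟨x, hxv⟩, ⟨y, hyv⟩, fun hm => hx ?_, fun hm => hy ?_, ?_, fun hm => hyC ⟨_, hm, rfl⟩, hxy⟩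
  · exact Finset.mem_insert_of_mem (Finset.mem_map.2 ⟨_, hm, rfl⟩)
  · exact Finset.mem_insert_of_mem (Finset.mem_map.2 ⟨_, hm, rfl⟩)
  · obtain ⟨x', hx', rfl⟩ := hxC
    exact hx'

open Classical in
/-- Edge connectivity is at least vertex connectivity. -/
theorem le_card_cut_of_cutConnected [Fintype V] {k : ℕ} (hk : k < Fintype.card V)
    (h : ∀ X : Finset V, X.card < k → G.CutConnected X) (C : Set V) (hC : C.Nonempty)
    (hC' : Cᶜ.Nonempty) :
    k ≤ (Finset.univ.filter fun p : V × V => G.Adj p.1 p.2 ∧ p.1 ∈ C ∧ p.2 ∉ C).card := by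
  by_contra! hlt
  -- A complete cut has `|C| * |Cᶜ| ≥ |V| - 1 ≥ k` edges.
  by_cases hall : ∀ a ∈ C, ∀ b ∉ C, G.Adj a b
  · have he : (Finset.univ.filter fun p : V × V => G.Adj p.1 p.2 ∧ p.1 ∈ C ∧ p.2 ∉ C) =
        (Finset.univ.filter (· ∈ C)) ×ˢ (Finset.univ.filter (· ∉ C)) := by
      ext ⟨a, b⟩
      simp only [Finset.mem_filter, Finset.mem_univ, true_and, Finset.mem_product]
      exact ⟨fun h => h.2, fun h => ⟨hall a h.1 b h.2, h⟩⟩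
    rw [he, Finset.card_product] at hlt
    have hsum := Finset.card_filter_add_card_filter_not (s := (Finset.univ : Finset V)) (· ∈ C)
    rw [Finset.card_univ] at hsum
    have h1 : 0 < (Finset.univ.filter (· ∈ C)).card :=
      Finset.card_pos.2 (hC.imp fun a ha => by simpa using ha)
    have h2 : 0 < (Finset.univ.filter (· ∉ C)).card :=
      Finset.card_pos.2 (hC'.imp fun a ha => by simpa using ha)
    nlinarith
  · push Not at hall
    obtain ⟨a, ha, b, hb, hab⟩ := hall
    set S := Finset.univ.filter fun p : V × V => G.Adj p.1 p.2 ∧ p.1 ∈ C ∧ p.2 ∉ C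
    -- One end of each cut edge, chosen to avoid the nonadjacent `a` and `b`; deleting these ends
    -- destroys the cut and so separates `a` from `b`.
    set g : V × V → V := fun p => if p.1 = a then p.2 else p.1 with hg
    have hX := h (S.image g) (Finset.card_image_le.trans_lt hlt)
    have haX : a ∉ (↑(S.image g) : Set V) := by
      intro hm
      obtain ⟨⟨p, q⟩, hp, he⟩ := Finset.mem_image.1 hm
      simp only [S, Finset.mem_filter, Finset.mem_univ, true_and] at hp
      by_cases hpa : p = a
      · simp only [hg, hpa, if_true] at he
        exact hp.2.2 (he ▸ ha)
      · simp only [hg, hpa, if_false] at he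
    have hbX : b ∉ (↑(S.image g) : Set V) := by
      intro hm
      obtain ⟨⟨p, q⟩, hp, he⟩ := Finset.mem_image.1 hm
      simp only [S, Finset.mem_filter, Finset.mem_univ, true_and] at hp
      by_cases hpa : p = a
      · simp only [hg, hpa, if_true] at he
        exact hab (hpa ▸ he ▸ hp.1)
      · simp only [hg, hpa, if_false] at he
        exact hb (he ▸ hp.2.1)
    obtain ⟨x, y, hx, hy, hxC, hyC, hxy⟩ := hX C a b haX hbX ha hb
    have hS : (x, y) ∈ S := by simp [S, hxy, hxC, hyC]
    have hm := Finset.mem_image_of_mem g hS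
    by_cases hxa : x = a
    · simp only [hg, hxa, if_true] at hm
      exact hy hm
    · simp only [hg, hxa, if_false] at hm
      exact hx hm

end SimpleGraph

/-! ### Complete minors from branch sets -/

namespace SimpleGraph

universe u w w'

theorem IsMinor.of_iso_left {W : Type w} {W' : Type w'} {H : SimpleGraph W} {H' : SimpleGraph W'}
    (e : H' ≃g H) {V : Type u} {G : SimpleGraph V} (h : H.IsMinor G) : H'.IsMinor G := by
  induction h with
  | iso φ => exact .iso (e.trans φ)
  | deleteVertex v _ ih => exact .deleteVertex v ih
  | deleteEdge s hs _ ih => exact .deleteEdge s hs ih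
  | contractEdge a b hab _ ih => exact .contractEdge a b hab ih

/-- The fibres of `f` over `some w` are the branch sets of a complete minor on `W`: they are
nonempty, connected, and pairwise joined by an edge. -/
structure IsBranchMap {V : Type u} {W : Type w} (G : SimpleGraph V) (f : V → Option W) : Prop where
  exists_eq_some : ∀ w, ∃ x, f x = some w
  connected : ∀ w x y, f x = some w → f y = some w →
    Relation.ReflTransGen (fun a b => G.Adj a b ∧ f a = some w ∧ f b = some w) x y
  exists_adj : ∀ w w', w ≠ w' → ∃ x y, G.Adj x y ∧ f x = some w ∧ f y = some w'

namespace IsBranchMap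

variable {V : Type u} {W : Type w} {G : SimpleGraph V} {f : V → Option W}

theorem induce_compl_singleton (h : G.IsBranchMap f) {v : V} (hv : f v = none) :
    (G.induce ({v}ᶜ : Set V)).IsBranchMap (fun x => f x) := by
  have key : ∀ x w, f x = some w → x ∈ ({v}ᶜ : Set V) := by
    rintro x w hx rfl
    simp [hv] at hx
  refine ⟨fun w => ?_, fun w x y hx hy => ?_, fun w w' hw => ?_⟩
  · obtain ⟨x, hx⟩ := h.exists_eq_some w
    exact ⟨⟨x, key x w hx⟩, hx⟩
  · obtain ⟨x, hx'⟩ := x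
    obtain ⟨y, hy'⟩ := y
    have hr := h.connected w x y hx hy
    clear hy
    induction hr with
    | refl => exact .refl
    | @tail b c _ hbc ih =>
      exact (ih (key b w hbc.2.1)).tail ⟨hbc.1, hbc.2.1, hbc.2.2⟩
  · obtain ⟨x, y, hxy, hx, hy⟩ := h.exists_adj w w' hw
    exact ⟨⟨x, key x w hx⟩, ⟨y, key y w' hy⟩, hxy, hx, hy⟩

/-- The projection onto the vertices of the contraction of an edge. -/
noncomputable def contractProj (u v x : V) : Option {x : V // x ≠ u ∧ x ≠ v} :=
  open Classical in if h : x ≠ u ∧ x ≠ v then some ⟨x, h⟩ else none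

theorem contractEdge (h : G.IsBranchMap f) {u v : V} (huv : f u = f v) :
    (G.contractEdge u v).IsBranchMap (fun x => x.elim (f u) fun y => f y) := by
  set f' : Option {x : V // x ≠ u ∧ x ≠ v} → Option W := fun x => x.elim (f u) fun y => f y
  have hf : ∀ x, f' (contractProj u v x) = f x := by
    intro x
    by_cases hx : x ≠ u ∧ x ≠ v
    · simp [f', contractProj, hx]
    · have : x = u ∨ x = v := by tauto
      rcases this with rfl | rfl <;> simp [f', contractProj, huv]
  have hadj : ∀ x y, G.Adj x y → contractProj u v x ≠ contractProj u v y →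
      (G.contractEdge u v).Adj (contractProj u v x) (contractProj u v y) := by
    intro x y hxy hne
    by_cases hx : x ≠ u ∧ x ≠ v <;> by_cases hy : y ≠ u ∧ y ≠ v
    · simpa [contractProj, hx, hy, SimpleGraph.contractEdge] using hxy
    · have : y = u ∨ y = v := by tauto
      rcases this with rfl | rfl <;>
        simp [contractProj, hx, SimpleGraph.contractEdge, hxy.symm]
    · have : x = u ∨ x = v := by tauto
      rcases this with rfl | rfl <;> simp [contractProj, hy, SimpleGraph.contractEdge, hxy]
    · simp [contractProj, hx, hy] at hne
  have hsurj : ∀ z, ∃ x, contractProj u v x = z := by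
    rintro (_ | ⟨x, hx⟩)
    · exact ⟨u, by simp [contractProj]⟩
    · exact ⟨x, by simp [contractProj, hx]⟩
  refine ⟨fun w => ?_, fun w x y hx hy => ?_, fun w w' hw => ?_⟩
  · obtain ⟨x, hx⟩ := h.exists_eq_some w
    exact ⟨contractProj u v x, by rw [hf, hx]⟩
  · obtain ⟨x, rfl⟩ := hsurj x
    obtain ⟨y, rfl⟩ := hsurj y
    rw [hf] at hx hy
    have hr := h.connected w x y hx hy
    clear hy
    induction hr with
    | refl => exact .refl
    | @tail b c _ hbc ih =>
      -- A step along the contracted edge collapses and is dropped.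
      by_cases he : contractProj u v b = contractProj u v c
      · exact he ▸ ih
      · exact ih.tail ⟨hadj b c hbc.1 he, by rw [hf, hbc.2.1], by rw [hf, hbc.2.2]⟩
  · obtain ⟨x, y, hxy, hx, hy⟩ := h.exists_adj w w' hw
    refine ⟨contractProj u v x, contractProj u v y, hadj x y hxy fun he => hw ?_,
      by rw [hf, hx], by rw [hf, hy]⟩
    rw [← Option.some_inj, ← hx, ← hy, ← hf x, ← hf y, he]

end IsBranchMap

/-- A finite graph with the branch sets of a complete minor has that complete minor. -/
theorem IsBranchMap.isMinor {V : Type u} {W : Type w} [Finite V] {G : SimpleGraph V}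
    {f : V → Option W} (h : G.IsBranchMap f) : (completeGraph W).IsMinor G := by
  induction hn : Nat.card V using Nat.strong_induction_on generalizing V with
  | _ n ih =>
    subst hn
    by_cases h0 : ∃ v, f v = none
    · obtain ⟨v, hv⟩ := h0
      refine .deleteVertex v (ih _ ?_ (h.induce_compl_singleton hv) rfl)
      exact Finite.card_subtype_lt (p := (· ∈ ({v}ᶜ : Set V))) (x := v) (by simp)
    by_cases h1 : ∃ u v, G.Adj u v ∧ f u = f v
    · obtain ⟨u, v, hadj, huv⟩ := h1
      refine .contractEdge u v hadj (ih _ ?_ (h.contractEdge huv) rfl)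
      have := Fintype.ofFinite V
      classical
      have e : Finset.univ.filter (fun x : V => x ≠ u ∧ x ≠ v) = (Finset.univ.erase u).erase v := by
        ext x
        simp [and_comm]
      rw [Finite.card_option, Nat.card_eq_fintype_card, Nat.card_eq_fintype_card,
        Fintype.card_subtype, e, Finset.card_erase_of_mem (by simp [hadj.ne']),
        Finset.card_erase_of_mem (by simp), Finset.card_univ]
      have : 1 < Fintype.card V := Fintype.one_lt_card_iff.2 ⟨u, v, hadj.ne⟩
      omega
    -- No vertex is unassigned and no edge lies inside a fibre, so the connected fibres are
    -- singletons.
    push Not at h0 h1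
    have hsome : ∀ v, ∃ w, f v = some w := fun v => Option.ne_none_iff_exists'.1 (h0 v)
    choose g hg using hsome
    have hinj : Function.Injective g := by
      intro x y hxy
      have hr := h.connected (g x) x y (hg x) (by rw [hxy, hg])
      rcases Relation.ReflTransGen.cases_head hr with h | ⟨c, hc, _⟩
      · exact h
      · exact absurd (hc.2.1.trans hc.2.2.symm) (h1 _ _ hc.1)
    have hsurj : Function.Surjective g := fun w => by
      obtain ⟨x, hx⟩ := h.exists_eq_some w
      exact ⟨x, by simpa [hg] using hx⟩
    refine .of_iso_left (Iso.symm ?_) (.iso (Iso.refl (G := G)))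
    refine ⟨Equiv.ofBijective g ⟨hinj, hsurj⟩, ?_⟩
    intro a b
    simp only [completeGraph, top_adj]
    refine ⟨fun hab => ?_, fun hab => hinj.ne hab.ne⟩
    obtain ⟨x, y, hxy, hx, hy⟩ := h.exists_adj _ _ hab
    rw [hg, Option.some_inj] at hx hy
    rwa [hinj hx, hinj hy] at hxy

end SimpleGraph

/-! ### Branch sets in the total graph -/

namespace SimpleGraph

universe u

variable {V : Type u} {G : SimpleGraph V}

/-- Every colour class of `c` is the edge set of a connected spanning subgraph: every proper
nonempty cut has an edge of each colour. -/
def IsSpanningColoring {ι : Type*} (G : SimpleGraph V) (c : G.edgeSet → Option ι) : Prop :=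
  ∀ (i : ι) (C : Set V),
    (∀ a b (hab : G.Adj a b), c ⟨s(a, b), hab⟩ = some i → (a ∈ C ↔ b ∈ C)) →
      ∀ a b, a ∈ C → b ∈ C

namespace IsSpanningColoring

variable {ι : Type*} {c : G.edgeSet → Option ι}

/-- Otherwise no edge of colour `i` crosses the proper cut `{u}`. -/
theorem exists_edge [Nontrivial V] (h : G.IsSpanningColoring c) (i : ι) (u : V) :
    ∃ w, ∃ hw : G.Adj u w, c ⟨s(u, w), hw⟩ = some i := by
  by_contra! hne
  obtain ⟨b, hb⟩ := exists_ne u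
  refine hb (h i {u} (fun x y hxy hc => ?_) u b rfl)
  have hx : x ≠ u := by
    rintro rfl
    exact hne _ hxy hc
  have hy : y ≠ u := by
    rintro rfl
    refine hne _ hxy.symm ?_
    rw [← hc]
    congr 2
    exact Sym2.eq_swap
  simp [hx, hy]

/-- Each colour class is connected in the line graph: no edge of the colour leaves the set of
vertices on its edges satisfying `P`. -/
theorem edge_induction (h : G.IsSpanningColoring c) (i : ι) {P : G.edgeSet → Prop}
    (hP : ∀ (e e' : G.edgeSet) (a : V), c e = some i → c e' = some i → a ∈ (e : Sym2 V) →
      a ∈ (e' : Sym2 V) → P e → P e') {e e' : G.edgeSet} (he : c e = some i)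
    (he' : c e' = some i) (hPe : P e) : P e' := by
  have hstep : ∀ a b (hab : G.Adj a b), c ⟨s(a, b), hab⟩ = some i →
      (∃ e, c e = some i ∧ a ∈ (e : Sym2 V) ∧ P e) → ∃ e, c e = some i ∧ b ∈ (e : Sym2 V) ∧ P e := by
    rintro a b hab hc ⟨e, he, hae, hPe⟩
    exact ⟨_, hc, Sym2.mem_mk_right a b, hP _ _ a he hc hae (Sym2.mem_mk_left a b) hPe⟩
  have key := h i {a | ∃ e, c e = some i ∧ a ∈ (e : Sym2 V) ∧ P e} fun a b hab hc =>
    ⟨hstep a b hab hc, hstep b a hab.symm (by rw [← hc]; congr 2; exact Sym2.eq_swap)⟩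
  obtain ⟨e₂, h1, h2, h3⟩ := key _ _ ⟨e, he, Sym2.out_fst_mem _, hPe⟩
  exact hP e₂ e' _ h1 he' h2 (Sym2.out_fst_mem (e' : Sym2 V)) h3

end IsSpanningColoring

section TotalGraph

variable {m : ℕ} {v : V}

/-- The inclusion of the edges of `G - v` into the edges of `G`. -/
def inclEdge (G : SimpleGraph V) (v : V) :
    (G.induce ({v}ᶜ : Set V)).edgeSet ↪ G.edgeSet :=
  (Embedding.induce ({v}ᶜ : Set V)).mapEdgeSet

theorem mem_inclEdge {e : (G.induce ({v}ᶜ : Set V)).edgeSet} {a : ({v}ᶜ : Set V)}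
    (ha : a ∈ (e : Sym2 ({v}ᶜ : Set V))) : (a : V) ∈ (inclEdge G v e : Sym2 V) :=
  Sym2.mem_map.2 ⟨a, ha, rfl⟩

theorem notMem_inclEdge (e : (G.induce ({v}ᶜ : Set V)).edgeSet) :
    v ∉ (inclEdge G v e : Sym2 V) := fun h => by
  obtain ⟨a, -, ha⟩ := Sym2.mem_map.1 h
  exact a.2 ha

open Classical in
/-- The branch sets in the total graph: all vertices, each edge at `v`, and the colour classes of
a partial edge colouring of `G - v`. -/
noncomputable def totalGraphBranchMap (c : (G.induce ({v}ᶜ : Set V)).edgeSet → Option (Fin m)) :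
    V ⊕ G.edgeSet → Option (Option ({e : G.edgeSet // v ∈ (e : Sym2 V)} ⊕ Fin m))
  | .inl _ => some none
  | .inr e =>
    if h : v ∈ (e : Sym2 V) then some (some (.inl ⟨e, h⟩))
    else (Function.extend (inclEdge G v) c (fun _ => none) e).map (some ∘ .inr)

variable {c : (G.induce ({v}ᶜ : Set V)).edgeSet → Option (Fin m)}

theorem totalGraphBranchMap_inclEdge (e : (G.induce ({v}ᶜ : Set V)).edgeSet) :
    totalGraphBranchMap c (.inr (inclEdge G v e)) = (c e).map (some ∘ .inr) := by
  simp [totalGraphBranchMap, notMem_inclEdge, (inclEdge G v).injective.extend_apply]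

theorem totalGraphBranchMap_of_mem {e : G.edgeSet} (h : v ∈ (e : Sym2 V)) :
    totalGraphBranchMap c (.inr e) = some (some (.inl ⟨e, h⟩)) := by
  simp [totalGraphBranchMap, h]

theorem totalGraphBranchMap_inr_ne (e : G.edgeSet) :
    totalGraphBranchMap c (.inr e) ≠ some none := by
  by_cases h : v ∈ (e : Sym2 V) <;> simp [totalGraphBranchMap, h]

theorem eq_of_totalGraphBranchMap_eq_inl {x : V ⊕ G.edgeSet}
    {e : {e : G.edgeSet // v ∈ (e : Sym2 V)}}
    (h : totalGraphBranchMap c x = some (some (.inl e))) : x = .inr e := by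
  rcases x with x | x
  · simp [totalGraphBranchMap] at h
  by_cases hx : v ∈ (x : Sym2 V)
  · rw [totalGraphBranchMap_of_mem hx] at h
    simp only [Option.some_inj, Sum.inl.injEq] at h
    rw [← h]
  · simp [totalGraphBranchMap, hx] at h

theorem exists_of_totalGraphBranchMap_eq_inr {x : V ⊕ G.edgeSet} {i : Fin m}
    (h : totalGraphBranchMap c x = some (some (.inr i))) :
    ∃ e, c e = some i ∧ x = .inr (inclEdge G v e) := by
  rcases x with x | x
  · simp [totalGraphBranchMap] at h
  by_cases hx : v ∈ (x : Sym2 V)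
  · simp [totalGraphBranchMap_of_mem hx] at h
  by_cases he : ∃ e, inclEdge G v e = x
  · obtain ⟨e, rfl⟩ := he
    rw [totalGraphBranchMap_inclEdge] at h
    exact ⟨e, by simpa using h, rfl⟩
  · simp [totalGraphBranchMap, hx, Function.extend_apply' _ _ _ he] at h

theorem totalGraph_adj_inr {e e' : G.edgeSet} {a : V} (hne : e ≠ e') (h : a ∈ (e : Sym2 V))
    (h' : a ∈ (e' : Sym2 V)) : G.totalGraph.Adj (.inr e) (.inr e') :=
  lineGraph_adj_iff_exists.2 ⟨hne, a, h, h'⟩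

/-- `hv` is needed because on a single vertex an empty colour class counts as spanning. -/
theorem isBranchMap_totalGraph (hG : G.Connected) [Nonempty ({v}ᶜ : Set V)]
    (hv : m ≠ 0 → Nontrivial ({v}ᶜ : Set V))
    (hc : (G.induce ({v}ᶜ : Set V)).IsSpanningColoring c) :
    G.totalGraph.IsBranchMap (totalGraphBranchMap c) := by
  have hedge : ∀ (i : Fin m) (u : ({v}ᶜ : Set V)), ∃ e : G.edgeSet, (u : V) ∈ (e : Sym2 V) ∧
      totalGraphBranchMap c (.inr e) = some (some (.inr i)) := by
    intro i u
    have := hv i.pos.ne'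
    obtain ⟨w, hw, hi⟩ := hc.exists_edge i u
    exact ⟨inclEdge G v ⟨s(u, w), hw⟩, mem_inclEdge (Sym2.mem_mk_left u w), by
      rw [totalGraphBranchMap_inclEdge, hi]
      rfl⟩
  obtain ⟨u₀⟩ : Nonempty ({v}ᶜ : Set V) := inferInstance
  have hvi : ∀ (e : {e : G.edgeSet // v ∈ (e : Sym2 V)}) (i : Fin m), ∃ x y,
      G.totalGraph.Adj x y ∧ totalGraphBranchMap c x = some (some (.inl e)) ∧
        totalGraphBranchMap c y = some (some (.inr i)) := by
    rintro ⟨⟨e, he⟩, hve⟩ i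
    obtain ⟨u, rfl⟩ := Sym2.mem_iff_exists.1 hve
    obtain ⟨e', hue, he'⟩ := hedge i ⟨u, (G.ne_of_adj he).symm⟩
    refine ⟨_, _, totalGraph_adj_inr (a := u) ?_ (Sym2.mem_mk_right v u) hue,
      totalGraphBranchMap_of_mem hve, he'⟩
    rintro rfl
    simp [totalGraphBranchMap_of_mem hve] at he'
  have hne : ∀ w, ∃ x y, G.totalGraph.Adj x y ∧ totalGraphBranchMap c x = some none ∧
      totalGraphBranchMap c y = some (some w) := by
    rintro (e | i)
    · exact ⟨.inl v, .inr e, e.2, rfl, totalGraphBranchMap_of_mem e.2⟩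
    · obtain ⟨e, hue, he⟩ := hedge i u₀
      exact ⟨.inl u₀, .inr e, hue, rfl, he⟩
  refine ⟨?_, ?_, ?_⟩
  · rintro (_ | e | i)
    · exact ⟨.inl v, rfl⟩
    · exact ⟨.inr e, totalGraphBranchMap_of_mem e.2⟩
    · obtain ⟨e, -, he⟩ := hedge i u₀
      exact ⟨_, he⟩
  · rintro (_ | e | i) x y hx hy
    · rcases x with x | x
      swap
      · exact absurd hx (totalGraphBranchMap_inr_ne x)
      rcases y with y | y
      swap
      · exact absurd hy (totalGraphBranchMap_inr_ne y)
      exact ((reachable_iff_reflTransGen x y).1 (hG.preconnected x y)).lift Sum.inl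
        fun a b hab => ⟨hab, rfl, rfl⟩
    · rw [eq_of_totalGraphBranchMap_eq_inl hx, eq_of_totalGraphBranchMap_eq_inl hy]
    · obtain ⟨e, he, rfl⟩ := exists_of_totalGraphBranchMap_eq_inr hx
      obtain ⟨e', he', rfl⟩ := exists_of_totalGraphBranchMap_eq_inr hy
      refine hc.edge_induction i (P := fun e' => Relation.ReflTransGen (fun a b =>
        G.totalGraph.Adj a b ∧ totalGraphBranchMap c a = some (some (.inr i)) ∧
          totalGraphBranchMap c b = some (some (.inr i)))
        (Sum.inr (inclEdge G v e)) (Sum.inr (inclEdge G v e'))) ?_ he he' .refl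
      intro e₁ e₂ a h₁ h₂ ha₁ ha₂ hr
      by_cases heq : e₁ = e₂
      · exact heq ▸ hr
      · refine hr.tail ⟨totalGraph_adj_inr ((inclEdge G v).injective.ne heq) (mem_inclEdge ha₁)
          (mem_inclEdge ha₂), ?_, ?_⟩
        · rw [totalGraphBranchMap_inclEdge, h₁]
          rfl
        · rw [totalGraphBranchMap_inclEdge, h₂]
          rfl
  · rintro (_ | e | i) (_ | e' | j) hw
    · exact absurd rfl hw
    · exact hne _
    · exact hne _
    · obtain ⟨x, y, hxy, hx, hy⟩ := hne (.inl e)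
      exact ⟨y, x, hxy.symm, hy, hx⟩
    · refine ⟨_, _, totalGraph_adj_inr ?_ e.2 e'.2, totalGraphBranchMap_of_mem e.2,
        totalGraphBranchMap_of_mem e'.2⟩
      intro h
      exact hw (by rw [Subtype.ext h])
    · exact hvi e j
    · obtain ⟨x, y, hxy, hx, hy⟩ := hne (.inr i)
      exact ⟨y, x, hxy.symm, hy, hx⟩
    · obtain ⟨x, y, hxy, hx, hy⟩ := hvi e' i
      exact ⟨y, x, hxy.symm, hy, hx⟩
    · obtain ⟨e, hue, he⟩ := hedge i u₀
      obtain ⟨e', hue', he'⟩ := hedge j u₀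
      refine ⟨_, _, totalGraph_adj_inr ?_ hue hue', he, he'⟩
      rintro rfl
      exact hw (Option.some_inj.1 (he.symm.trans he'))

end TotalGraph

theorem card_edges_at_eq_degree [Fintype V] [DecidableRel G.Adj] (v : V) :
    Nat.card {e : G.edgeSet // v ∈ (e : Sym2 V)} = G.degree v := by
  classical
  rw [← card_incidenceSet_eq_degree, ← Nat.card_eq_fintype_card]
  exact Nat.card_congr
    (Equiv.subtypeSubtypeEquivSubtypeInter (· ∈ G.edgeSet) (fun e : Sym2 V => v ∈ e))

end SimpleGraph

/-! ### Assembly -/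

theorem theorem4p2 {V : Type*} [Fintype V] (G : SimpleGraph V) [DecidableRel G.Adj]
    (k : ℕ) (hk : 1 ≤ k) (hG : G.IsVertexConnected (2 * k - 1)) :
    (SimpleGraph.completeGraph (Fin (G.maxDegree + k))).IsMinor G.totalGraph := by
  classical
  obtain ⟨m, rfl⟩ := Nat.exists_eq_add_of_le' hk
  rw [show 2 * (m + 1) - 1 = 2 * m + 1 by omega] at hG
  have hconn : G.Connected := by
    have h := hG.2 ∅ (by simp)
    rw [Finset.coe_empty, Set.compl_empty] at h
    exact (SimpleGraph.induceUnivIso G).connected_iff.1 h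
  have hcard := hG.1
  have : Nonempty V := hconn.nonempty
  obtain ⟨v, hv⟩ := G.exists_maximal_degree_vertex
  have hcard' : Fintype.card ({v}ᶜ : Set V) = Fintype.card V - 1 := by
    rw [Fintype.card_compl_set, Set.card_singleton]
  obtain ⟨c, hc⟩ := SimpleGraph.exists_disjoint_spanning (G := G.induce ({v}ᶜ : Set V)) m
    (SimpleGraph.le_card_cut_of_cutConnected (by omega) (hG.cutConnected_induce v))
  have hne : Nonempty ({v}ᶜ : Set V) := Fintype.card_pos_iff.1 (by omega)
  have hmin := (SimpleGraph.isBranchMap_totalGraph hconn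
    (fun hm => Fintype.one_lt_card_iff_nontrivial.1 (by omega)) hc).isMinor
  refine .of_iso_left (SimpleGraph.Iso.completeGraph (Finite.equivFinOfCardEq ?_).symm) hmin
  rw [Finite.card_option, Nat.card_sum, SimpleGraph.card_edges_at_eq_degree, Nat.card_fin, hv,
    add_assoc]
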